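/- A word $w$ over a linearly ordered alphabet contains a permutation pattern $\sigma$ of $\{1,\dots,k\}$ if some subsequence of $w$ is order isomorphic to $\sigma$; otherwise $w$ avoids $\sigma$. Let $\sigma$ be either of the patterns $123$ or $231$, and for $r\ge 1$, $n\ge 0$ let $w_r(n)$ be the number of $\sigma$-avoiding words in the alphabet $\{1,\dots,n\}$ with exactly $r$ occurrences of each letter. Then the following hold (for both choices of $\sigma$). (a) $w_1(n)$ is the $n$-th Catalan number, and for all $n\ge 0$ $$-2\,\frac{(1+2n)\,w_1(n)}{n+2}+w_1(n+1)=0 .$$ (b) The generating function $F(x)=\sum_{n\ge 0}w_2(n)x^n$ satisfies the identity of formal power series $$1-(2x+1)F^2+x(x+4)F^4=0 ,$$ and for all $n\ge 0$ (the Godbole–Goyt–Herdan–Pudwell conjecture) $$-3\,\frac{(7n+12)(1+2n)(1+n)\,w_2(n)}{(2n+5)(7n+5)(n+2)}-\frac{(528+1426n+1215n^2+329n^3)\,w_2(n+1)}{2(2n+5)(7n+5)(n+2)}+w_2(n+2)=0 .$$ (c) For all $n\ge 0$ $$-\frac{64}{3}\,\frac{(4n+1)(2n+3)(4n+3)(14n+25)(n+1)\,w_3(n)}{(3n+5)(1+2n)(3n+7)(14n+11)(n+2)}-\frac{8}{3}\,\frac{(3975+20322n+39676n^2+37144n^3+16736n^4+2912n^5)\,w_3(n+1)}{(3n+5)(1+2n)(3n+7)(14n+11)(n+2)}+w_3(n+2)=0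 .$$ -/

import Mathlib

/-- The word `w` contains the pattern `σ` (a permutation of `k` symbols in one-line notation
`σ 0, …, σ (k - 1)`): some subsequence of `w` is order isomorphic to `σ`. -/
def ContainsPattern {α : Type*} [LinearOrder α] {k : ℕ} (w : List α) (σ : Equiv.Perm (Fin k)) :
    Prop :=
  ∃ s : Fin k → α, (List.ofFn s).Sublist w ∧ ∀ a b : Fin k, s a < s b ↔ σ a < σ b

/-- The pattern `123`. -/
def pattern123 : Equiv.Perm (Fin 3) := Equiv.refl (Fin 3)

/-- The pattern `231`: in the zero-based one-line notation it is `1, 2, 0`. -/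
def pattern231 : Equiv.Perm (Fin 3) := finRotate 3

/-- The words on an alphabet of `n` letters, with exactly `r` occurrences of each letter,
that avoid the pattern `σ`. -/
def avoidingWords {k : ℕ} (σ : Equiv.Perm (Fin k)) (r n : ℕ) : Set (List (Fin n)) :=
  {w | (∀ a : Fin n, w.count a = r) ∧ ¬ ContainsPattern w σ}

/-- The number of words in `avoidingWords σ r n`. -/
noncomputable def wordCount {k : ℕ} (σ : Equiv.Perm (Fin k)) (r n : ℕ) : ℕ :=
  (avoidingWords σ r n).ncard

/-- There are only finitely many such words, so `wordCount` is their true number. -/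
theorem avoidingWords_finite {k : ℕ} (σ : Equiv.Perm (Fin k)) (r n : ℕ) :
    (avoidingWords σ r n).Finite := by
  refine (List.finite_length_eq (Fin n) (n * r)).subset ?_
  intro w hw
  have h : ∑ a : Fin n, w.count a = w.length := by
    simpa using Multiset.sum_count_eq_card (s := Finset.univ) (m := (w : Multiset (Fin n)))
      (fun a _ => Finset.mem_univ a)
  simp only [hw.1, Finset.sum_const, Finset.card_univ, Fintype.card_fin, smul_eq_mul] at h
  exact h.symm

/-- The ordinary generating function of the numbers `wordCount σ r n`, `n = 0, 1, 2, …`. -/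
noncomputable def wordGF {k : ℕ} (σ : Equiv.Perm (Fin k)) (r : ℕ) : PowerSeries ℤ :=
  PowerSeries.mk fun n => (wordCount σ r n : ℤ)

/-! Both patterns forbid a subsequence x, y, z with z below x and y and with x, y out of order for a
relation R: R is ≥ for 231, and ≤ for 123 after reversing the word. In a word with no such triple, a
new least letter may occur only within or directly after the maximal initial R-run, since later it
would complete a triple. So the number of ways to insert it depends only on the length of that run.

Weight a word by `runPoly k`, k being its initial run length and `runPoly` a rescaled Chebyshev
family. By `sum_shuffles_runLength`, the weights over all interleavings of two ordered chains sum to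
a product, so inserting r copies of a least letter multiplies the total weight by `runPoly r`
(`sum_shuffles_runWeight`). The total weight over n letters is therefore `runPoly r ^ n`. The
functional taking X^n to the n-th Catalan number takes every `runPoly k` to 1, so it turns total
weight into a count (`wordCount_eq_catalanFunctional`).

The rest concerns Catalan moments of powers of a fixed polynomial. Integration by parts and creative
telescoping give the recurrences for r = 2, 3. For the quartic, 1 / (1 - x * `runPoly 2`) is split
into partial fractions whose moments are Catalan series. -/

section CatalanMoments

open Polynomial

/-! ### Interleavings and initial runs -/

/-- All the ways of interleaving two lists. -/
def shuffles {α : Type*} : List α → List α → List (List α)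
  | [], m => [m]
  | a :: l, [] => [a :: l]
  | a :: l, b :: m =>
    (shuffles l (b :: m)).map (List.cons a) ++ (shuffles (a :: l) m).map (List.cons b)
termination_by l m => l.length + m.length

section Shuffles

variable {α : Type*}

theorem shuffles_nil_left (m : List α) : shuffles [] m = [m] := by rw [shuffles]

theorem shuffles_nil_right (l : List α) : shuffles l [] = [l] := by
  cases l <;> rw [shuffles]

theorem shuffles_cons_cons (a b : α) (l m : List α) :
    shuffles (a :: l) (b :: m) =
      (shuffles l (b :: m)).map (List.cons a) ++ (shuffles (a :: l) m).map (List.cons b) := by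
  rw [shuffles]

theorem shuffles_perm_swap (l m : List α) : (shuffles l m).Perm (shuffles m l) := by
  fun_induction shuffles l m with
  | case1 m => rw [shuffles_nil_right]
  | case2 a l => rw [shuffles_nil_left]
  | case3 a l b m ih₁ ih₂ =>
    rw [shuffles_cons_cons]
    exact List.perm_append_comm.trans ((ih₂.map _).append (ih₁.map _))

theorem length_shuffles (l m : List α) :
    (shuffles l m).length = (l.length + m.length).choose m.length := by
  fun_induction shuffles l m with
  | case1 m => simp
  | case2 a l => simp
  | case3 a l b m ih₁ ih₂ =>
    simp only [List.length_append, List.length_map, ih₁, ih₂, List.length_cons]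
    rw [show l.length + 1 + (m.length + 1) = (l.length + m.length + 1) + 1 by ring,
      Nat.choose_succ_succ, add_comm, show l.length + 1 + m.length = l.length + m.length + 1 by ring,
      show l.length + (m.length + 1) = l.length + m.length + 1 by ring]

theorem mem_or_mem_of_mem_shuffles {l m u : List α} (hu : u ∈ shuffles l m) {x : α} (hx : x ∈ u) :
    x ∈ l ∨ x ∈ m := by
  fun_induction shuffles l m generalizing u with
  | case1 m => simp_all
  | case2 a l => simp_all
  | case3 a l b m ih₁ ih₂ =>
    simp only [List.mem_append, List.mem_map] at hu
    rcases hu with ⟨v, hv, rfl⟩ | ⟨v, hv, rfl⟩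
    · rcases List.mem_cons.1 hx with rfl | hx
      · simp
      · rcases ih₁ hv hx with h | h <;> simp_all
    · rcases List.mem_cons.1 hx with rfl | hx
      · simp
      · rcases ih₂ hv hx with h | h <;> simp_all

theorem nodup_shuffles {l m : List α} (h : ∀ a ∈ l, ∀ b ∈ m, a ≠ b) : (shuffles l m).Nodup := by
  fun_induction shuffles l m with
  | case1 m => simp
  | case2 a l => simp
  | case3 a l b m ih₁ ih₂ =>
    refine List.Nodup.append ((ih₁ fun x hx y hy => h x (by simp [hx]) y hy).map
      List.cons_injective) ((ih₂ fun x hx y hy => h x hx y (by simp [hy])).map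
      List.cons_injective) ?_
    intro u hu hu'
    simp only [List.mem_map] at hu hu'
    obtain ⟨v, -, rfl⟩ := hu
    obtain ⟨v', -, hv'⟩ := hu'
    exact h a (by simp) b (by simp) (List.cons.inj hv').1.symm

theorem mem_shuffles_replicate [DecidableEq α] {c : α} {l : List α} (hc : c ∉ l) (r : ℕ)
    (w : List α) :
    w ∈ shuffles l (List.replicate r c) ↔ w.filter (fun x => x ≠ c) = l ∧ w.count c = r := by
  induction w generalizing l r with
  | nil =>
    cases l <;> cases r <;>
      simp [shuffles_nil_left, shuffles_nil_right, shuffles_cons_cons, List.replicate_succ]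
  | cons x w ih =>
    have hnil : ∀ r : ℕ, x :: w = List.replicate (r + 1) c ↔ x = c ∧ w = List.replicate r c := by
      intro r; rw [List.replicate_succ, List.cons.injEq]
    by_cases hx : x = c
    · subst hx
      cases r with
      | zero =>
        simp only [List.replicate_zero, shuffles_nil_right, List.mem_singleton,
          List.count_cons_self, Nat.add_eq_zero_iff, one_ne_zero, and_false, iff_false]
        rintro rfl
        simp at hc
      | succ r =>
        have := ih hc r
        cases l with
        | nil =>
          simp only [shuffles_nil_left, List.mem_singleton] at this ⊢
          rw [hnil, this]; simp
        | cons a l =>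
          have ha : a ≠ x := by rintro rfl; simp at hc
          rw [List.replicate_succ, shuffles_cons_cons]
          simp [this, ha]
    · cases l with
      | nil =>
        have h : x :: w ≠ List.replicate r c := by
          intro h
          exact hx (List.eq_of_mem_replicate (h ▸ List.mem_cons_self (a := x) (l := w)))
        simp [shuffles_nil_left, hx, h]
      | cons a l =>
        have hcl : c ∉ l := fun h => hc (by simp [h])
        have := ih hcl r
        cases r with
        | zero =>
          simp only [List.replicate_zero, shuffles_nil_right, List.mem_singleton] at this ⊢
          rw [List.cons.injEq, this]
          simp [hx, and_assoc]
        | succ r =>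
          rw [List.replicate_succ, shuffles_cons_cons, ← List.replicate_succ]
          simp only [List.mem_append, List.mem_map, List.cons.injEq]
          constructor
          · rintro (⟨v, hv, rfl, rfl⟩ | ⟨v, hv, rfl, rfl⟩)
            · obtain ⟨h1, h2⟩ := this.1 hv
              exact ⟨by simpa [hx] using h1, by simpa [hx] using h2⟩
            · exact absurd rfl hx
          · rintro ⟨h1, h2⟩
            simp only [List.count_cons, beq_iff_eq, hx, if_false, add_zero] at h2
            simp only [ne_eq, hx, not_false_eq_true, decide_true, List.filter_cons_of_pos,
              List.cons.injEq] at h1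
            exact Or.inl ⟨w, this.2 ⟨by simpa using h1.2, h2⟩, h1.1.symm, rfl⟩

/-- The length of the longest prefix in which consecutive entries are related. -/
def runLength (R : α → α → Prop) [DecidableRel R] : List α → ℕ
  | [] => 0
  | [_] => 1
  | a :: b :: l => if R a b then runLength R (b :: l) + 1 else 1

variable (R : α → α → Prop) [DecidableRel R]

theorem runLength_cons_of_forall {a : α} {u : List α} (h : ∀ b ∈ u, R a b) :
    runLength R (a :: u) = runLength R u + 1 := by
  cases u with
  | nil => simp [runLength]
  | cons b u => simp [runLength, h b (by simp)]

theorem runLength_cons_cons_of_not {a b : α} {u : List α} (h : ¬ R a b) :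
    runLength R (a :: b :: u) = 1 := by
  simp [runLength, h]

theorem runLength_of_pairwise {u : List α} (h : u.Pairwise R) : runLength R u = u.length := by
  induction u with
  | nil => simp [runLength]
  | cons a u ih =>
    rw [List.pairwise_cons] at h
    rw [runLength_cons_of_forall R h.1, ih h.2, List.length_cons]

end Shuffles

/-! ### Chebyshev-type polynomials -/

/-- The polynomials `s ^ k * U_k s`, for the Chebyshev polynomials `U_k` of the second kind on
`[-2, 2]`, as polynomials in `s ^ 2`. -/
noncomputable def runPoly : ℕ → ℤ[X]
  | 0 => 1
  | 1 => X
  | k + 2 => X * (runPoly (k + 1) - runPoly k)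

/-- The coefficient of `t ^ r` in `(∑ i, runPoly i * t ^ i) / (1 - t) ^ k`. -/
noncomputable def runPolySum : ℕ → ℕ → ℤ[X]
  | 0, r => runPoly r
  | _ + 1, 0 => 1
  | k + 1, r + 1 => runPolySum (k + 1) r + runPolySum k (r + 1)

theorem runPoly_add_two (k : ℕ) : runPoly (k + 2) = X * (runPoly (k + 1) - runPoly k) := rfl

theorem runPolySum_zero_right (k : ℕ) : runPolySum k 0 = 1 := by
  cases k <;> simp [runPolySum, runPoly]

theorem runPolySum_one_right (k : ℕ) : runPolySum k 1 = X + (k : ℤ[X]) := by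
  induction k with
  | zero => simp [runPolySum, runPoly]
  | succ k ih => rw [runPolySum, ih, runPolySum_zero_right]; push_cast; ring

/-- Since ∑ `runPoly i` t^i = 1 / (1 - Xt + Xt²), multiplying the generating function of `runPolySum
k` by 1 - Xt + Xt² leaves 1 / (1 - t)^k, whose coefficients are the binomials here. -/
theorem runPolySum_add_two (k r : ℕ) :
    runPolySum k (r + 2) = X * (runPolySum k (r + 1) - runPolySum k r)
      + ((k + r + 1).choose (r + 2) : ℤ[X]) := by
  induction k generalizing r with
  | zero => simp [runPolySum, runPoly_add_two]
  | succ k ihk =>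
    have hs (r : ℕ) : runPolySum (k + 1) (r + 1) = runPolySum (k + 1) r + runPolySum k (r + 1) := by
      rw [runPolySum]
    have hc (r : ℕ) : ((k + 1 + r + 1).choose (r + 2) : ℤ[X]) =
        ((k + r + 1).choose (r + 1) : ℤ[X]) + ((k + r + 1).choose (r + 2) : ℤ[X]) := by
      rw [show k + 1 + r + 1 = k + r + 1 + 1 by ring, Nat.choose_succ_succ]; push_cast; ring
    induction r with
    | zero =>
      have h := hc 0
      rw [hs, ihk, h]
      simp only [zero_add, runPolySum_one_right, runPolySum_zero_right]
      simp
      ring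
    | succ r ihr =>
      have h := hc (r + 1)
      rw [show k + (r + 1) + 1 = k + 1 + r + 1 by ring] at h
      have ihk' := ihk (r + 1)
      rw [show k + (r + 1) + 1 = k + 1 + r + 1 by ring] at ihk'
      linear_combination hs (r + 2) + ihk' + ihr - X * hs (r + 1) + X * hs r - h

/-- The addition formula U_{m+n} = U_m U_n - U_{m-1} U_{n-1}, rescaled. -/
theorem runPoly_add (j r : ℕ) :
    runPoly (j + 1 + (r + 1)) = runPoly (j + 1) * runPoly (r + 1) - X * runPoly j * runPoly r := by
  induction r using Nat.twoStepInduction generalizing j with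
  | zero => rw [show j + 1 + (0 + 1) = j + 2 by ring, runPoly_add_two]; simp [runPoly]; ring
  | one =>
    rw [show j + 1 + (1 + 1) = j + 1 + 2 by ring, runPoly_add_two, runPoly_add_two]
    simp [runPoly]; ring
  | more r ih₁ ih₂ =>
    rw [show j + 1 + (r + 2 + 1) = j + 1 + (r + 1) + 2 by ring, runPoly_add_two,
      show j + 1 + (r + 1) + 1 = j + 1 + (r + 1 + 1) by ring, ih₁, ih₂,
      show r + 2 + 1 = r + 1 + 2 by ring, runPoly_add_two (r + 1), runPoly_add_two r]
    ring

/-! ### Weighted interleavings of two chains -/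

section ChainShuffles

variable {α : Type*} (R : α → α → Prop) [DecidableRel R]

/-- Once a letter of the upper chain has come first, the next letter of `l` ends the run. The shift
`j` stands for run letters already read, which lets the induction peel off `c`. -/
theorem sum_shuffles_runLength_cons (c : α) (l m : List α) (hm : (c :: m).Pairwise R)
    (h : ∀ a ∈ l, ∀ b ∈ c :: m, ¬ R b a) (j : ℕ) :
    ((shuffles l m).map fun u => runPoly (j + runLength R (c :: u))).sum
      = runPoly (j + 1) * runPolySum l.length m.length
        - (match m.length with
          | 0 => 0
          | r + 1 => X * runPoly j * runPolySum l.length r) := by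
  cases l with
  | nil =>
    rw [shuffles_nil_left]
    simp only [List.map_cons, List.map_nil, List.sum_cons, List.sum_nil, add_zero,
      runLength_of_pairwise R hm, List.length_cons, List.length_nil, runPolySum]
    cases m with
    | nil => simp [runPoly]
    | cons b m =>
      simp only [List.length_cons]
      rw [← runPoly_add]
      congr 1; ring
  | cons a l =>
    induction m generalizing c j with
    | nil =>
      simp [shuffles_nil_right, runLength_cons_cons_of_not R (h a (by simp) c (by simp)),
        runPolySum]
    | cons b m ih =>
      rw [shuffles_cons_cons]
      have hcb : R c b := (List.pairwise_cons.1 hm).1 b (by simp)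
      have e (u : List α) :
          runPoly (j + runLength R (c :: b :: u)) = runPoly (j + 1 + runLength R (b :: u)) := by
        simp only [runLength, hcb, if_true]; congr 1; ring
      simp only [List.map_append, List.map_map, List.sum_append, Function.comp_def,
        runLength_cons_cons_of_not R (h a (by simp) c (by simp)), e]
      rw [ih b (List.pairwise_cons.1 hm).2 (j + 1)
        (fun x hx y hy => h x hx y (List.mem_cons_of_mem _ hy))]
      rw [List.map_const', List.sum_replicate, length_shuffles]
      simp only [List.length_cons, nsmul_eq_mul, runPoly_add_two]
      cases m with
      | nil =>
        simp only [List.length_nil, zero_add, runPolySum_one_right, runPolySum_zero_right]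
        simp
        ring
      | cons b' m =>
        simp only [List.length_cons]
        rw [runPolySum_add_two, show l.length + (m.length + 1 + 1) = l.length + 1 + m.length + 1
          by ring]
        ring

/-- A leading letter of `l` always prolongs the run and is absorbed into `j`; a leading letter of
`m` is the case of `sum_shuffles_runLength_cons`. -/
theorem sum_shuffles_runLength_shift (l m : List α) (hl : l.Pairwise R) (hm : m.Pairwise R)
    (h : ∀ a ∈ l, ∀ b ∈ m, R a b ∧ ¬ R b a) (j : ℕ) :
    ((shuffles l m).map fun u => runPoly (j + runLength R u)).sum
      = runPoly (j + l.length) * runPoly m.length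
        - (match m.length with
          | 0 => 0
          | r + 1 => (X * runPoly j - runPoly (j + 1)) * runPolySum l.length r) := by
  cases m with
  | nil => simp [shuffles_nil_right, runLength_of_pairwise R hl, runPoly]
  | cons b m =>
    induction l generalizing j with
    | nil =>
      simp only [shuffles_nil_left, List.map_cons, List.map_nil, List.sum_cons, List.sum_nil,
        runLength_of_pairwise R hm, List.length_cons, List.length_nil, runPolySum, add_zero]
      cases j with
      | zero => simp [runPoly]
      | succ j =>
        rw [runPoly_add, runPoly_add_two]; ring
    | cons a l ih =>
      have e (u : List α) (hu : u ∈ shuffles l (b :: m)) :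
          runPoly (j + runLength R (a :: u)) = runPoly (j + 1 + runLength R u) := by
        rw [runLength_cons_of_forall]
        · congr 1; ring
        · intro x hx
          rcases mem_or_mem_of_mem_shuffles hu hx with hx | hx
          · exact (List.pairwise_cons.1 hl).1 x hx
          · exact (h a (by simp) x hx).1
      rw [shuffles_cons_cons]
      simp only [List.map_append, List.map_map, List.sum_append, Function.comp_def]
      rw [List.map_congr_left e, ih (List.pairwise_cons.1 hl).2 (j + 1)
        (fun x hx => h x (List.mem_cons_of_mem _ hx)),
        sum_shuffles_runLength_cons R b (a :: l) m hm (fun x hx y hy => (h x hx y hy).2)]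
      simp only [List.length_cons, runPoly_add_two]
      rw [show j + 1 + l.length = j + (l.length + 1) by ring]
      cases m with
      | nil =>
        simp only [List.length_nil, runPolySum_zero_right]; ring
      | cons b' m =>
        simp only [List.length_cons]
        rw [show runPolySum (l.length + 1) (m.length + 1) =
          runPolySum (l.length + 1) m.length + runPolySum l.length (m.length + 1) by
            rw [runPolySum]]
        ring

/-- Summing over the interleavings of two chains, the first of which lies below the second. -/
theorem sum_shuffles_runLength (l m : List α) (hl : l.Pairwise R) (hm : m.Pairwise R)
    (h : ∀ a ∈ l, ∀ b ∈ m, R a b ∧ ¬ R b a) :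
    ((shuffles l m).map fun u => runPoly (runLength R u)).sum
      = runPoly l.length * runPoly m.length := by
  have := sum_shuffles_runLength_shift R l m hl hm h 0
  simp only [zero_add] at this
  rw [this]
  -- At `j = 0` the correction vanishes, because X * `runPoly 0` = `runPoly 1`.
  cases m.length <;> simp [runPoly]

end ChainShuffles

/-! ### Inserting a new least letter -/

section Insertion

variable {α : Type*}

theorem List.append_singleton_sublist_of_notMem {l u m : List α} {c : α}
    (h : (l ++ [c]).Sublist (u ++ m)) (hc : c ∉ m) : (l ++ [c]).Sublist u := by
  obtain ⟨l₁, l₂, e, h₁, h₂⟩ := List.sublist_append_iff.1 h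
  rcases List.eq_nil_or_concat l₂ with rfl | ⟨l₂', d, rfl⟩
  · rw [e]; simpa using h₁
  · rw [List.concat_eq_append, ← List.append_assoc] at e
    obtain rfl : c = d := by simpa using (List.append_inj' e rfl).2
    exact absurd (h₂.subset (by simp)) hc

theorem exists_pairwise_append (R : α → α → Prop) [IsTrans α R] (v : List α) :
    ∃ t m, v = t ++ m ∧ t.Pairwise R ∧
      (m = [] ∨ ∃ t' x h m', t = t' ++ [x] ∧ m = h :: m' ∧ ¬ R x h) := by
  classical
  induction v with
  | nil => exact ⟨[], [], by simp⟩
  | cons a v ih =>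
    obtain ⟨t, m, rfl, ht, hm⟩ := ih
    cases t with
    | nil =>
      rcases hm with rfl | ⟨t', x, h, m', ht', -⟩
      · exact ⟨[a], [], by simp⟩
      · simp at ht'
    | cons b t =>
      by_cases hab : R a b
      · refine ⟨a :: b :: t, m, rfl, List.pairwise_cons.2 ⟨fun x hx => ?_, ht⟩, ?_⟩
        · rcases List.mem_cons.1 hx with rfl | hx
          · exact hab
          · exact _root_.trans hab ((List.pairwise_cons.1 ht).1 x hx)
        · rcases hm with rfl | ⟨t', x, h, m', ht', hm', hx⟩
          · exact Or.inl rfl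
          · exact Or.inr ⟨a :: t', x, h, m', by rw [ht']; rfl, hm', hx⟩
      · exact ⟨[a], b :: t ++ m, rfl, by simp, Or.inr ⟨[], a, b, t ++ m, rfl, rfl, hab⟩⟩

theorem runLength_append_cons (R : α → α → Prop) [DecidableRel R] {u : List α} (hu : u ≠ [])
    {h : α} (m : List α) (hR : u.IsChain R → ∀ u' x, u = u' ++ [x] → ¬ R x h) :
    runLength R (u ++ h :: m) = runLength R u := by
  induction u with
  | nil => exact absurd rfl hu
  | cons a u ih =>
    cases u with
    | nil => simp [runLength, hR (by simp) [] a rfl]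
    | cons b u =>
      by_cases hab : R a b
      · have := ih (by simp) (fun hc u' x hx => hR (by simp [hab, hc]) (a :: u') x (by rw [hx]; rfl))
        simp only [List.cons_append] at this
        simp [runLength, hab, this]
      · simp [runLength, hab]

variable [LinearOrder α]

/-- The word has a subsequence `x, y, z` with `z` below `x` and `y`, and `x`, `y` not related. -/
def HasBadTriple (R : α → α → Prop) (w : List α) : Prop :=
  ∃ x y z, [x, y, z].Sublist w ∧ ¬ R x y ∧ z < x ∧ z < y

open Classical in
/-- The weight of a word in the count of words without bad triples. -/
noncomputable def runWeight (R : α → α → Prop) [DecidableRel R] (w : List α) : ℤ[X] :=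
  if HasBadTriple R w then 0 else runPoly (runLength R w)

theorem HasBadTriple.mono {R : α → α → Prop} {v w : List α} (h : HasBadTriple R v)
    (hvw : v.Sublist w) : HasBadTriple R w := by
  obtain ⟨x, y, z, hs, hxy⟩ := h
  exact ⟨x, y, z, hs.trans hvw, hxy⟩

/-- Inserting copies of a new least letter multiplies the total weight by `runPoly r`. -/
theorem sum_shuffles_runWeight (R : α → α → Prop) [DecidableRel R] [IsTrans α R] {c : α}
    {v : List α} (hcc : R c c) (hcv : ∀ a ∈ v, c < a)
    (hR : (∀ a ∈ v, R c a ∧ ¬ R a c) ∨ (∀ a ∈ v, R a c ∧ ¬ R c a)) (r : ℕ) :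
    ((shuffles v (List.replicate r c)).map (runWeight R)).sum = runPoly r * runWeight R v := by
  classical
  have hc : c ∉ v := fun h => lt_irrefl c (hcv c h)
  by_cases hv : HasBadTriple R v
  · have hz : (shuffles v (List.replicate r c)).map (runWeight R) =
        (shuffles v (List.replicate r c)).map (fun _ => 0) := by
      refine List.map_congr_left fun w hw => ?_
      rw [mem_shuffles_replicate hc] at hw
      have : HasBadTriple R w := hv.mono (hw.1 ▸ List.filter_sublist)
      simp [runWeight, this]
    rw [hz]
    simp [runWeight, hv]
  -- Here `t` is the maximal initial run. The surviving words are the `u ++ m` with `u` an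
  -- interleaving of `t` and the copies of `c`.
  obtain ⟨t, m, rfl, ht, hm⟩ := exists_pairwise_append R v
  have hct : c ∉ t := fun h => hc (by simp [h])
  have hcm : c ∉ m := fun h => hc (by simp [h])
  have hfm : m.filter (fun x => x ≠ c) = m := by
    rw [List.filter_eq_self]
    intro a ha
    simpa using fun h : a = c => hcm (h ▸ ha)
  -- The run never crosses into `m`, even when `u` ends in `c`: either `c` cannot follow a letter of
  -- `t`, so that `u` is no chain, or the first letter of `m` cannot follow `c`.
  have hlast : ∀ u, u.filter (fun x => x ≠ c) = t → runLength R (u ++ m) = runLength R u := by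
    intro u hu
    rcases hm with rfl | ⟨t', x, h, m', ht', rfl, hx⟩
    · simp
    · refine runLength_append_cons R ?_ m' ?_
      · rintro rfl
        simp [ht'] at hu
      · rintro hch u' y rfl
        by_cases hy : y = c
        · subst hy
          rcases hR with hR | hR
          · have hxt : x ∈ t := by simp [ht']
            have hxu : x ∈ u' := by
              rw [← hu, List.mem_filter] at hxt
              have := hxt.1
              simp only [List.mem_append, List.mem_singleton] at this
              rcases this with h | h
              · exact h
              · exact absurd hxt.2 (by simp [h])
            have := (List.pairwise_append.1 (List.isChain_iff_pairwise.1 hch)).2.2 x hxu y (by simp)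
            exact absurd this (hR x (by simp [ht'])).2
          · exact (hR h (by simp)).2
        · rw [List.filter_append, ht'] at hu
          have : [y].filter (fun x => x ≠ c) = [y] := by simp [hy]
          rw [this] at hu
          have := (List.append_inj' hu rfl).2
          simp only [List.cons.injEq, and_true] at this
          exact this ▸ hx
  have hft : t.filter (fun x => x ≠ c) = t := by
    rw [List.filter_eq_self]
    intro a ha
    simpa using fun h : a = c => hct (h ▸ ha)
  have hne : ∀ l : List α, c ∉ l → ∀ a ∈ l, ∀ b ∈ List.replicate r c, a ≠ b := by
    intro l hl a ha b hb hab
    exact hl (List.eq_of_mem_replicate hb ▸ hab ▸ ha)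
  -- A bad triple ending in `c` would lie inside `u`, with its first two letters in the chain `t`;
  -- any other would already be in `t ++ m`.
  have hbad : ∀ u ∈ shuffles t (List.replicate r c), ¬ HasBadTriple R (u ++ m) := by
    intro u hu
    rw [mem_shuffles_replicate hct] at hu
    rintro ⟨x, y, z, hs, hxy, hzx, hzy⟩
    have hf : (u ++ m).filter (fun x => x ≠ c) = t ++ m := by
      rw [List.filter_append, hu.1, hfm]
    by_cases hz : z = c
    · subst hz
      have h1 : [x, y, z].Sublist u :=
        List.append_singleton_sublist_of_notMem (l := [x, y]) hs hcm
      have h2 := h1.filter (fun a => a ≠ z)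
      rw [hu.1] at h2
      simp only [ne_eq, hzx.ne', hzy.ne', not_false_eq_true, decide_true,
        List.filter_cons_of_pos, not_true_eq_false, decide_false, List.filter_cons,
        List.filter_nil] at h2
      simp at h2
      exact hxy (by simpa using ht.sublist h2)
    · have hzc : c < z := by
        have : z ∈ (u ++ m).filter (fun x => x ≠ c) := by
          rw [List.mem_filter]
          exact ⟨hs.subset (by simp), by simpa using hz⟩
        rw [hf] at this
        exact hcv z this
      have h2 := hs.filter (fun a => a ≠ c)
      rw [hf] at h2
      have e : [x, y, z].filter (fun a => a ≠ c) = [x, y, z] := by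
        simp [hz, (hzc.trans hzx).ne', (hzc.trans hzy).ne']
      rw [e] at h2
      exact hv ⟨x, y, z, h2, hxy, hzx, hzy⟩
  have hnd : ((shuffles t (List.replicate r c)).map (· ++ m)).Nodup :=
    (nodup_shuffles (hne t hct)).map (List.append_left_injective m)
  have hsum : ((shuffles (t ++ m) (List.replicate r c)).map (runWeight R)).sum =
      (((shuffles t (List.replicate r c)).map (· ++ m)).map (runWeight R)).sum := by
    rw [← List.sum_toFinset _ (nodup_shuffles (hne _ hc)), ← List.sum_toFinset _ hnd]
    symm
    apply Finset.sum_subset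
    · intro w hw
      simp only [List.mem_toFinset, List.mem_map] at hw ⊢
      obtain ⟨u, hu, rfl⟩ := hw
      rw [mem_shuffles_replicate hct] at hu
      rw [mem_shuffles_replicate hc, List.filter_append, hu.1, hfm, List.count_append, hu.2,
        List.count_eq_zero_of_not_mem hcm]
      exact ⟨rfl, rfl⟩
    · intro w hw hw'
      -- In any other word some `c` comes after the first letter `h` of `m`; with the last letter
      -- `x` of `t` this gives the bad triple `x, h, c`.
      have hb : HasBadTriple R w := by
        simp only [List.mem_toFinset, List.mem_map, not_exists, not_and] at hw hw'
        rcases hm with rfl | ⟨t', x, h, m', ht', rfl, hx⟩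
        · exact absurd (List.append_nil w) (hw' w (by simpa using hw))
        · rw [mem_shuffles_replicate hc] at hw
          obtain ⟨hwf, hwc⟩ := hw
          obtain ⟨u, w', rfl, hu, hw2⟩ := List.filter_eq_append_iff.1 hwf
          obtain ⟨u₂, w₂, rfl, hu₂, hh, hw₂⟩ := List.filter_eq_cons_iff.1 hw2
          have hcw : c ∈ w₂ := by
            by_contra hcw
            have e : w₂ = m' := by
              rw [← hw₂, eq_comm, List.filter_eq_self]
              intro a ha
              simpa using fun h : a = c => hcw (h ▸ ha)
            subst e
            refine hw' (u ++ u₂) ?_ (by simp)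
            rw [mem_shuffles_replicate hct]
            constructor
            · rw [List.filter_append, hu, List.filter_eq_nil_iff.2 hu₂, List.append_nil]
            · rw [← hwc]
              have : List.count c (h :: w₂) = 0 := List.count_eq_zero_of_not_mem hcm
              simp only [List.count_append, this]
              omega
          have hxu : x ∈ u := by
            have : x ∈ t := by simp [ht']
            rw [← hu] at this
            exact (List.mem_filter.1 this).1
          refine ⟨x, h, c, ?_, hx, hcv x (by simp [ht']), hcv h (by simp)⟩
          refine List.Sublist.append (l₁ := [x]) (List.singleton_sublist.2 hxu) ?_
          refine List.Sublist.trans ?_ (List.sublist_append_right _ _)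
          exact List.Sublist.cons_cons _ (List.singleton_sublist.2 hcw)
      simp [runWeight, hb]
  -- The copies of `c` form the first or the second chain according to the direction of `R`.
  have hrun : ((shuffles t (List.replicate r c)).map fun u => runPoly (runLength R u)).sum =
      runPoly t.length * runPoly r := by
    have hrep : (List.replicate r c).Pairwise R := List.pairwise_replicate.2 (Or.inr hcc)
    rcases hR with hR | hR
    · rw [((shuffles_perm_swap t _).map _).sum_eq, sum_shuffles_runLength R _ _ hrep ht,
        List.length_replicate, mul_comm]
      intro a ha b hb
      rw [List.eq_of_mem_replicate ha]
      exact hR b (by simp [hb])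
    · rw [sum_shuffles_runLength R _ _ ht hrep, List.length_replicate]
      intro a ha b hb
      rw [List.eq_of_mem_replicate hb]
      exact hR a (by simp [ha])
  rw [hsum, List.map_map]
  have hcongr : ∀ u ∈ shuffles t (List.replicate r c),
      (runWeight R ∘ (· ++ m)) u = runPoly (runLength R u) := by
    intro u hu
    rw [Function.comp_apply, runWeight, if_neg (hbad u hu)]
    rw [hlast u ((mem_shuffles_replicate hct r u).1 hu).1]
  rw [List.map_congr_left hcongr, hrun, runWeight, if_neg hv, hlast t hft,
    runLength_of_pairwise R ht, mul_comm]

end Insertion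

/-! ### From total weight to Catalan moments -/

section Counting

variable {α : Type*} [LinearOrder α]

theorem mem_toFinset_lists {M : Multiset α} {w : List α} :
    w ∈ M.lists.toFinset ↔ M = (w : Multiset α) := by
  rw [Multiset.mem_toFinset, Multiset.mem_lists_iff]
  rfl

/-- Induction adding a new minimum `c`: words are grouped by what remains after deleting `c`, and
each fibre is a set of interleavings. -/
theorem sum_lists_runWeight (R : α → α → Prop) [DecidableRel R] [IsTrans α R] [Std.Refl R]
    (hR : (∀ a b, a < b → R a b ∧ ¬ R b a) ∨ (∀ a b, a < b → R b a ∧ ¬ R a b)) (r : ℕ)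
    (s : Finset α) :
    ∑ w ∈ (r • s.val).lists.toFinset, runWeight R w = runPoly r ^ s.card := by
  classical
  induction s using Finset.induction_on_min with
  | empty =>
    have : (r • (∅ : Finset α).val).lists.toFinset = {[]} := by
      ext w
      rw [mem_toFinset_lists]; simp [eq_comm]
    rw [this]
    have : ¬ HasBadTriple R ([] : List α) := by
      rintro ⟨x, y, z, h, -⟩
      simp at h
    simp [runWeight, this, runLength, runPoly]
  | insert c s hc ih =>
    have hcs : c ∉ s := fun h => lt_irrefl c (hc c h)
    have hval : r • (insert c s).val = Multiset.replicate r c + r • s.val := by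
      rw [Finset.insert_val_of_notMem hcs, ← Multiset.singleton_add, nsmul_add,
        Multiset.nsmul_singleton]
    have hcv : ∀ v : List α, r • s.val = (v : Multiset α) → ∀ a ∈ v, c < a := by
      intro v hv a ha
      have : a ∈ r • s.val := by rw [hv]; simpa using ha
      exact hc a (Multiset.mem_of_mem_nsmul this)
    have hcr : c ∉ r • s.val := fun h => hcs (Multiset.mem_of_mem_nsmul h)
    have hfr : (r • s.val).filter (fun x => x ≠ c) = r • s.val := by
      rw [Multiset.filter_eq_self]
      rintro a ha rfl
      exact hcr ha
    rw [hval, Finset.card_insert_of_notMem hcs, pow_succ', ← ih, Finset.mul_sum,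
      ← Finset.sum_fiberwise_of_maps_to (s := (Multiset.replicate r c + r • s.val).lists.toFinset)
        (t := (r • s.val).lists.toFinset) (g := fun w => w.filter (fun x => x ≠ c))]
    · refine Finset.sum_congr rfl fun v hv => ?_
      have hv' : r • s.val = (v : Multiset α) := by
        simpa only [mem_toFinset_lists] using hv
      have hcv' := hcv v hv'
      have hcnv : c ∉ v := fun h => lt_irrefl c (hcv' c h)
      rw [← sum_shuffles_runWeight R (refl_of R c) hcv' (hR.imp (fun h a ha => h c a (hcv' a ha))
        (fun h a ha => h c a (hcv' a ha))), ← List.sum_toFinset _ (nodup_shuffles ?_)]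
      · refine Finset.sum_congr ?_ fun _ _ => rfl
        ext w
        rw [List.mem_toFinset, mem_shuffles_replicate hcnv, Finset.mem_filter,
          mem_toFinset_lists]
        constructor
        · rintro ⟨hw, hf⟩
          refine ⟨hf, ?_⟩
          have := congrArg (Multiset.count c) hw
          simpa [Multiset.count_eq_zero_of_notMem hcr, hcs] using this.symm
        · rintro ⟨hf, hw⟩
          refine ⟨?_, hf⟩
          rw [hv', ← hf]
          ext a
          by_cases ha : a = c
          · subst ha
            simp [hw]
          · simp [Multiset.count_replicate, Ne.symm ha, List.count_filter, ha]
      · intro a ha b hb hab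
        exact hcnv (List.eq_of_mem_replicate hb ▸ hab ▸ ha)
    · intro w hw
      simp only [mem_toFinset_lists] at hw ⊢
      have := congrArg (Multiset.filter (fun x => x ≠ c)) hw
      rw [Multiset.filter_add, hfr, Multiset.filter_eq_nil.2, zero_add] at this
      · simpa using this
      · intro a ha
        simpa using Multiset.eq_of_mem_replicate ha

/-- The linear functional sending `X ^ n` to the `n`-th Catalan number. -/
noncomputable def catalanFunctional : ℤ[X] →ₗ[ℤ] ℤ :=
  Polynomial.lsum fun n => (catalan n : ℤ) • LinearMap.id

theorem catalanFunctional_X_pow (n : ℕ) : catalanFunctional (X ^ n) = catalan n := by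
  simp [catalanFunctional, Polynomial.lsum_apply, X_pow_eq_monomial, Polynomial.sum_monomial_index]

theorem catalan_succ_eq_choose_sub (m : ℕ) :
    (catalan (m + 1) : ℤ) = (2 * m + 2).choose (m + 1) - (2 * m + 2).choose m := by
  have h1 := succ_mul_catalan_eq_centralBinom (m + 1)
  rw [Nat.centralBinom_eq_two_mul_choose, show 2 * (m + 1) = 2 * m + 2 by ring] at h1
  have h2 := Nat.choose_succ_right_eq (2 * m + 2) m
  rw [show 2 * m + 2 - m = m + 2 by omega] at h2
  have h3 : (m + 2 : ℤ) ≠ 0 := by positivity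
  apply mul_left_cancel₀ h3
  zify at h1 h2
  linear_combination h1 - h2

/-- The Catalan moments of the polynomials `runPoly k` are the ballot numbers. -/
theorem catalanFunctional_X_pow_mul_runPoly (m k : ℕ) :
    catalanFunctional (X ^ m * runPoly k) =
      ((2 * m + k).choose m : ℤ) - (match m with | 0 => 0 | i + 1 => ((2 * m + k).choose i : ℤ)) := by
  induction k using Nat.twoStepInduction generalizing m with
  | zero =>
    simp only [runPoly, mul_one, catalanFunctional_X_pow]
    cases m with
    | zero => simp
    | succ m => exact catalan_succ_eq_choose_sub m
  | one =>
    simp only [runPoly, ← pow_succ, catalanFunctional_X_pow]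
    rw [catalan_succ_eq_choose_sub]
    have h : (2 * m + 1).choose (m + 1) = (2 * m + 1).choose m := Nat.choose_symm_half m
    cases m with
    | zero => simp
    | succ m =>
      simp only [Nat.choose_succ_succ (2 * (m + 1) + 1), h]
      push_cast
      ring
  | more k ih₁ ih₂ =>
    -- The factor X raises `m` by one, and the three-term recurrence becomes Pascal's rule.
    rw [runPoly_add_two, ← mul_assoc, ← pow_succ, mul_sub, map_sub, ih₁, ih₂]
    rw [show 2 * (m + 1) + (k + 1) = 2 * m + (k + 2) + 1 by ring,
      show 2 * (m + 1) + k = 2 * m + (k + 2) by ring]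
    cases m with
    | zero => simp
    | succ m =>
      simp only [Nat.choose_succ_succ (2 * (m + 1) + (k + 2))]
      push_cast
      ring

theorem catalanFunctional_runPoly (k : ℕ) : catalanFunctional (runPoly k) = 1 := by
  simpa using catalanFunctional_X_pow_mul_runPoly 0 k

theorem ncard_not_hasBadTriple [Fintype α] (R : α → α → Prop) [DecidableRel R] [IsTrans α R]
    [Std.Refl R]
    (hR : (∀ a b, a < b → R a b ∧ ¬ R b a) ∨ (∀ a b, a < b → R b a ∧ ¬ R a b)) (r : ℕ) :
    ({w : List α | (∀ a, w.count a = r) ∧ ¬ HasBadTriple R w}.ncard : ℤ) =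
      catalanFunctional (runPoly r ^ Fintype.card α) := by
  classical
  rw [← Finset.card_univ, ← sum_lists_runWeight R hR, map_sum]
  have h : {w : List α | (∀ a, w.count a = r) ∧ ¬ HasBadTriple R w} =
      ((r • (Finset.univ : Finset α).val).lists.toFinset.filter (fun w => ¬ HasBadTriple R w) :
        Finset (List α)) := by
    ext w
    simp only [Set.mem_ofPred_eq, Finset.coe_filter, mem_toFinset_lists]
    refine and_congr_left fun _ => ?_
    rw [Multiset.ext]
    simp [Multiset.count_nsmul, eq_comm]
  rw [h, Set.ncard_coe_finset, Finset.card_filter]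
  push_cast
  refine Finset.sum_congr rfl fun w _ => ?_
  by_cases hw : HasBadTriple R w <;> simp [runWeight, hw, catalanFunctional_runPoly]

theorem containsPattern_pattern231 (w : List α) :
    ContainsPattern w pattern231 ↔ HasBadTriple (fun a b => b ≤ a) w := by
  constructor
  · rintro ⟨s, hs, h⟩
    refine ⟨s 0, s 1, s 2, by simpa [List.ofFn_succ] using hs, ?_, ?_, ?_⟩
    · exact not_le.2 ((h 0 1).2 (by decide))
    · exact (h 2 0).2 (by decide)
    · exact (h 2 1).2 (by decide)
  · rintro ⟨x, y, z, hs, hxy, hzx, hzy⟩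
    have hxy := not_le.1 hxy
    refine ⟨![x, y, z], by simpa [List.ofFn_succ] using hs, ?_⟩
    simp only [Fin.forall_fin_succ]
    simp [pattern231, hxy, hzx, hzy, hxy.le, hzx.le, hzy.le]

theorem containsPattern_pattern123 (w : List α) :
    ContainsPattern w pattern123 ↔ HasBadTriple (fun a b => a ≤ b) w.reverse := by
  constructor
  · rintro ⟨s, hs, h⟩
    refine ⟨s 2, s 1, s 0, ?_, ?_, ?_, ?_⟩
    · simpa [List.ofFn_succ] using List.reverse_sublist.2 hs
    · exact not_le.2 ((h 1 2).2 (by decide))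
    · exact (h 0 2).2 (by decide)
    · exact (h 0 1).2 (by decide)
  · rintro ⟨x, y, z, hs, hxy, hzx, hzy⟩
    have hxy := not_le.1 hxy
    refine ⟨![z, y, x], ?_, ?_⟩
    · simpa [List.ofFn_succ] using List.reverse_sublist.2 hs
    simp only [Fin.forall_fin_succ]
    simp [pattern123, hxy, hzx, hzy, hxy.le, hzx.le, hzy.le]

/-- The number of words avoiding `123` or `231`, as a Catalan moment. -/
theorem wordCount_eq_catalanFunctional {σ : Equiv.Perm (Fin 3)}
    (hσ : σ = pattern123 ∨ σ = pattern231) (r n : ℕ) :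
    (wordCount σ r n : ℤ) = catalanFunctional (runPoly r ^ n) := by
  rcases hσ with rfl | rfl
  · have := ncard_not_hasBadTriple (α := Fin n) (fun a b => a ≤ b)
      (Or.inl fun a b h => ⟨h.le, not_le.2 h⟩) r
    rw [Fintype.card_fin] at this
    rw [← this, wordCount, ← Set.ncard_image_of_injective _ List.reverse_injective]
    congr 2
    ext w
    simp only [avoidingWords, containsPattern_pattern123, Set.mem_image, Set.mem_ofPred_eq]
    constructor
    · rintro ⟨v, ⟨h1, h2⟩, rfl⟩
      exact ⟨by simpa using h1, h2⟩
    · rintro ⟨h1, h2⟩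
      exact ⟨w.reverse, ⟨by simpa using h1, by simpa using h2⟩, by simp⟩
  · have := ncard_not_hasBadTriple (α := Fin n) (fun a b => b ≤ a)
      (Or.inr fun a b h => ⟨h.le, not_le.2 h⟩) r
    rw [Fintype.card_fin] at this
    rw [← this, wordCount, avoidingWords]
    simp only [containsPattern_pattern231]

end Counting

/-! ### Creative telescoping -/

section Recurrences

theorem succ_succ_mul_catalan_succ (n : ℕ) :
    (n + 2) * catalan (n + 1) = 2 * (2 * n + 1) * catalan n := by
  have h1 := succ_mul_catalan_eq_centralBinom (n + 1)
  have h2 := succ_mul_catalan_eq_centralBinom n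
  have h3 := Nat.succ_mul_centralBinom_succ n
  apply Nat.eq_of_mul_eq_mul_left n.succ_pos
  rw [← h1, ← h2] at h3
  linarith

/-- Integration by parts for the Catalan moments. -/
theorem catalanFunctional_integration_by_parts (q : ℤ[X]) :
    catalanFunctional (X * (4 - X) * derivative q + (2 - 2 * X) * q) = 0 := by
  induction q using Polynomial.induction_on' with
  | add p q hp hq =>
    rw [← add_zero (0 : ℤ)]
    nth_rewrite 1 [← hp]
    rw [← hq, ← map_add, derivative_add]
    congr 1
    ring
  | monomial n a =>
    -- Catalan numbers are the moments of a multiple of w = √((4 - x)/x) on [0, 4]. As x(4 - x)w'/w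
    -- = -2, the claim is that (x(4 - x)qw)' integrates to 0; on monomials it is the Catalan
    -- recurrence.
    have h : X * (4 - X) * derivative (monomial n a) + (2 - 2 * X) * monomial n a =
        (a * (2 * (2 * n + 1))) • (X ^ n : ℤ[X]) - (a * (n + 2)) • X ^ (n + 1) := by
      rw [← C_mul_X_pow_eq_monomial]
      cases n with
      | zero => simp [smul_eq_C_mul]; ring
      | succ n => simp [smul_eq_C_mul]; ring
    have hc := succ_succ_mul_catalan_succ n
    zify at hc
    rw [h, map_sub, map_smul, map_smul, catalanFunctional_X_pow, catalanFunctional_X_pow]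
    simp only [smul_eq_mul]
    linear_combination -a * hc

/-- Creative telescoping for the Catalan moments of the powers of `P`. -/
theorem catalanFunctional_pow_recurrence {P S G : ℤ[X]} {n : ℕ} {c₀ c₁ c₂ : ℤ}
    (hG : X * derivative P * S = P * G)
    (h : (c₀ : ℤ[X]) + (c₁ : ℤ[X]) * P + (c₂ : ℤ[X]) * P ^ 2 =
      (4 - X) * ((n : ℤ[X]) * G + X * derivative S) + (2 - 2 * X) * S) :
    c₀ * catalanFunctional (P ^ n) + c₁ * catalanFunctional (P ^ (n + 1))
      + c₂ * catalanFunctional (P ^ (n + 2)) = 0 := by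
  have hd : X * derivative (P ^ n * S) = P ^ n * ((n : ℤ[X]) * G + X * derivative S) := by
    cases n with
    | zero => simp
    | succ n =>
      rw [derivative_mul, derivative_pow]
      simp only [Nat.add_sub_cancel, map_natCast]
      linear_combination (((n + 1 : ℕ) : ℤ[X]) * P ^ n) * hG
  have key := catalanFunctional_integration_by_parts (P ^ n * S)
  have e : X * (4 - X) * derivative (P ^ n * S) + (2 - 2 * X) * (P ^ n * S) =
      c₀ • P ^ n + c₁ • P ^ (n + 1) + c₂ • P ^ (n + 2) := by
    simp only [zsmul_eq_mul]
    linear_combination (4 - X) * hd - P ^ n * h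
  rw [e, map_add, map_add, map_smul, map_smul, map_smul] at key
  simpa using key

theorem runPoly_two : runPoly 2 = X * (X - 1) := rfl

theorem runPoly_three : runPoly 3 = X * (X * (X - 1) - X) := rfl

theorem catalanFunctional_runPoly_two_recurrence (n : ℕ) :
    (-6 * (7 * n + 12) * (1 + 2 * n) * (1 + n) : ℤ) * catalanFunctional (runPoly 2 ^ n)
      + (-(528 + 1426 * n + 1215 * n ^ 2 + 329 * n ^ 3) : ℤ)
        * catalanFunctional (runPoly 2 ^ (n + 1))
      + (2 * (2 * n + 5) * (7 * n + 5) * (n + 2) : ℤ)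
        * catalanFunctional (runPoly 2 ^ (n + 2)) = 0 := by
  set N : ℤ[X] := (n : ℤ[X]) with hN
  have hN' : derivative N = 0 := by simp [hN]
  apply catalanFunctional_pow_recurrence
    -- The factor X - 1 clears the denominator of X P'/P = (2X - 1)/(X - 1). Comparing powers of X
    -- then gives five linear equations for the three coefficients of the quadratic factor and the
    -- three `cᵢ`.
    (S := (X - 1) * ((36 + 57 * N + 21 * N ^ 2) + (-40 - 81 * N - 35 * N ^ 2) * X
      + (-20 - 38 * N - 14 * N ^ 2) * X ^ 2))
    (G := (2 * X - 1) * ((36 + 57 * N + 21 * N ^ 2) + (-40 - 81 * N - 35 * N ^ 2) * X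
      + (-20 - 38 * N - 14 * N ^ 2) * X ^ 2))
  · rw [runPoly_two]; simp; ring
  · rw [runPoly_two]; simp [hN', derivative_pow]; simp only [← hN]; ring

theorem catalanFunctional_runPoly_three_recurrence (n : ℕ) :
    (-64 * (4 * n + 1) * (2 * n + 3) * (4 * n + 3) * (14 * n + 25) * (n + 1) : ℤ)
        * catalanFunctional (runPoly 3 ^ n)
      + (-8 * (3975 + 20322 * n + 39676 * n ^ 2 + 37144 * n ^ 3 + 16736 * n ^ 4 + 2912 * n ^ 5) : ℤ)
        * catalanFunctional (runPoly 3 ^ (n + 1))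
      + (3 * (3 * n + 5) * (1 + 2 * n) * (3 * n + 7) * (14 * n + 11) * (n + 2) : ℤ)
        * catalanFunctional (runPoly 3 ^ (n + 2)) = 0 := by
  set N : ℤ[X] := (n : ℤ[X]) with hN
  have hN' : derivative N = 0 := by simp [hN]
  -- Likewise X P'/P = (3X - 4)/(X - 2), and a quartic `q` leaves seven equations in eight unknowns.
  set q : ℤ[X] := (3600 + 12816 * N + 16448 * N ^ 2 + 9024 * N ^ 3 + 1792 * N ^ 4)
    + (3000 + 11480 * N + 15488 * N ^ 2 + 8800 * N ^ 3 + 1792 * N ^ 4) * X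
    + (-1320 - 6080 * N - 9692 * N ^ 2 - 6352 * N ^ 3 - 1456 * N ^ 4) * X ^ 2
    + (-330 - 1498 * N - 2340 * N ^ 2 - 1496 * N ^ 3 - 336 * N ^ 4) * X ^ 3
    + (-330 - 1443 * N - 2127 * N ^ 2 - 1248 * N ^ 3 - 252 * N ^ 4) * X ^ 4 with hq
  apply catalanFunctional_pow_recurrence (S := (X - 2) * q) (G := (3 * X - 4) * q)
  · rw [runPoly_three]; simp; ring
  · rw [runPoly_three, hq]; simp [hN', derivative_pow]; simp only [← hN]; ring

end Recurrences

/-! ### The algebraic equation for r = 2 -/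

section GeneratingFunction

/-- The coefficientwise application of the Catalan functional. -/
noncomputable def catalanMoment (f : PowerSeries ℤ[X]) : PowerSeries ℤ :=
  PowerSeries.mk fun n => catalanFunctional (PowerSeries.coeff n f)

theorem catalanMoment_sub (f g : PowerSeries ℤ[X]) :
    catalanMoment (f - g) = catalanMoment f - catalanMoment g := by
  ext n
  simp [catalanMoment]

theorem catalanMoment_map_mul (p : PowerSeries ℤ) (f : PowerSeries ℤ[X]) :
    catalanMoment (PowerSeries.map C p * f) = p * catalanMoment f := by
  ext n
  simp only [catalanMoment, PowerSeries.coeff_mk, PowerSeries.coeff_mul, map_sum,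
    PowerSeries.coeff_map]
  refine Finset.sum_congr rfl fun i _ => ?_
  rw [← smul_eq_C_mul, map_smul, smul_eq_mul]

/-- The Catalan moment of the geometric series `1 / (1 - P y)`. -/
theorem exists_geometric_catalanMoment (P : ℤ[X]) {y : PowerSeries ℤ}
    (hy : PowerSeries.constantCoeff y = 0) :
    ∃ K : PowerSeries ℤ[X], (1 - PowerSeries.C P * PowerSeries.map C y) * K = 1 ∧
      catalanMoment K = (PowerSeries.mk fun n => catalanFunctional (P ^ n)).subst y := by
  have hy' : PowerSeries.HasSubst y := PowerSeries.HasSubst.of_constantCoeff_zero' hy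
  have hyC : PowerSeries.HasSubst (PowerSeries.map (C : ℤ →+* ℤ[X]) y) :=
    PowerSeries.HasSubst.of_constantCoeff_zero' (by
      rw [← PowerSeries.coeff_zero_eq_constantCoeff_apply, PowerSeries.coeff_map,
        PowerSeries.coeff_zero_eq_constantCoeff_apply, hy, map_zero])
  refine ⟨(PowerSeries.mk fun n => P ^ n).subst (PowerSeries.map C y), ?_, ?_⟩
  · have h : (1 - PowerSeries.C P * PowerSeries.X) * (PowerSeries.mk fun n => P ^ n) = 1 := by
      ext n
      rw [sub_mul, one_mul, mul_assoc]
      cases n with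
      | zero => simp
      | succ n => simp [PowerSeries.coeff_succ_X_mul, PowerSeries.coeff_one, pow_succ']
    have := congrArg (PowerSeries.substAlgHom hyC) h
    have hC : PowerSeries.substAlgHom hyC (PowerSeries.C P) = PowerSeries.C P := by
      rw [PowerSeries.coe_substAlgHom]
      exact PowerSeries.subst_C _
    rw [map_mul, map_sub, map_one, map_mul, hC, PowerSeries.substAlgHom_X,
      PowerSeries.coe_substAlgHom] at this
    exact this
  · ext n
    rw [catalanMoment, PowerSeries.coeff_mk, PowerSeries.coeff_subst' hyC,
      PowerSeries.coeff_subst' hy']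
    rw [← LinearMap.toAddMonoidHom_coe, AddMonoidHom.map_finsum _
      (PowerSeries.coeff_subst_finite' hyC _ n)]
    refine finsum_congr fun d => ?_
    rw [← map_pow, PowerSeries.coeff_map, PowerSeries.coeff_mk, PowerSeries.coeff_mk,
      smul_eq_mul, smul_eq_mul, mul_comm, ← smul_eq_C_mul, LinearMap.toAddMonoidHom_coe, map_smul,
      smul_eq_mul, mul_comm]

/-- If `f` were nonzero, dividing out its power of X would leave a series with nonzero constant
term, which substitution preserves. This lets the equation be checked after a change of variable. -/
theorem PowerSeries.eq_zero_of_subst_eq_zero {y f : PowerSeries ℤ}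
    (hy : PowerSeries.constantCoeff y = 0) (hy0 : y ≠ 0) (h : f.subst y = 0) : f = 0 := by
  have hs : PowerSeries.HasSubst y := PowerSeries.HasSubst.of_constantCoeff_zero' hy
  by_contra hf
  rw [← PowerSeries.X_pow_order_mul_divXPowOrder (f := f), PowerSeries.subst_mul hs,
    PowerSeries.subst_pow hs, PowerSeries.subst_X hs] at h
  rcases mul_eq_zero.1 h with h | h
  · exact pow_ne_zero _ hy0 h
  · have hg := PowerSeries.eq_X_mul_shift_add_const f.divXPowOrder
    have := congrArg (PowerSeries.substAlgHom hs) hg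
    rw [PowerSeries.coe_substAlgHom, h, ← PowerSeries.coe_substAlgHom hs, map_add, map_mul,
      PowerSeries.substAlgHom_X] at this
    have h2 := congrArg PowerSeries.constantCoeff this
    have h3 : PowerSeries.substAlgHom hs (PowerSeries.C (PowerSeries.constantCoeff f.divXPowOrder)) =
        PowerSeries.C (PowerSeries.constantCoeff f.divXPowOrder) := by
      rw [PowerSeries.coe_substAlgHom]
      exact PowerSeries.subst_C _
    rw [h3, map_add, map_mul, hy] at h2
    simp only [map_zero, zero_mul, zero_add] at h2
    rw [PowerSeries.constantCoeff_C, eq_comm, PowerSeries.constantCoeff_divXPowOrder_eq_zero_iff] at h2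
    exact hf h2

/-- The Catalan generating function. -/
theorem catalan_generatingFunction {y : PowerSeries ℤ} (hy : PowerSeries.constantCoeff y = 0) :
    ∃ c : PowerSeries ℤ, c = 1 + y * c ^ 2 ∧
      (PowerSeries.mk fun n => (catalan n : ℤ)).subst y = c := by
  have hs : PowerSeries.HasSubst y := PowerSeries.HasSubst.of_constantCoeff_zero' hy
  refine ⟨_, ?_, rfl⟩
  have h : (PowerSeries.mk fun n => (catalan n : ℤ)) =
      1 + PowerSeries.X * (PowerSeries.mk fun n => (catalan n : ℤ)) ^ 2 := by
    have := congrArg (PowerSeries.map (Nat.castRingHom ℤ))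
      PowerSeries.catalanSeries_sq_mul_X_add_one
    have e : PowerSeries.map (Nat.castRingHom ℤ) PowerSeries.catalanSeries =
        PowerSeries.mk fun n => (catalan n : ℤ) := by
      ext n
      simp
    rw [map_add, map_mul, map_pow, e, map_one, PowerSeries.map_X] at this
    rw [add_comm, mul_comm]
    exact this.symm
  have := congrArg (PowerSeries.substAlgHom hs) h
  rw [map_add, map_mul, map_pow, map_one, PowerSeries.substAlgHom_X,
    PowerSeries.coe_substAlgHom] at this
  exact this

theorem algebraic_equation_of_catalanFunctional {F : PowerSeries ℤ}
    (hF : F = PowerSeries.mk fun n => catalanFunctional (runPoly 2 ^ n)) :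
    1 - (2 * PowerSeries.X + 1) * F ^ 2
      + PowerSeries.X * (PowerSeries.X + 4) * F ^ 4 = 0 := by
  -- The factorization 1 - xX(X - 1) = (1 - aX)(1 - bX) needs a + b = ab = -x. With `a` as the free
  -- variable no square root is needed: b = -a/(1 - a) and x = a²/(1 - a).
  set a : PowerSeries ℤ := PowerSeries.X with ha
  obtain ⟨u, hu⟩ : ∃ u : PowerSeries ℤ, u * (1 - a) = 1 :=
    ⟨_, PowerSeries.mk_one_mul_one_sub_eq_one ℤ⟩
  obtain ⟨b, hb⟩ : ∃ b : PowerSeries ℤ, b = -(a * u) := ⟨_, rfl⟩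
  obtain ⟨x, hx⟩ : ∃ x : PowerSeries ℤ, x = a ^ 2 * u := ⟨_, rfl⟩
  have ha0 : PowerSeries.constantCoeff a = 0 := PowerSeries.constantCoeff_X
  have hb0 : PowerSeries.constantCoeff b = 0 := by simp [hb, ha0]
  have hx0 : PowerSeries.constantCoeff x = 0 := by simp [hx, ha0]
  have hu0 : u ≠ 0 := by rintro rfl; simp at hu
  have ha0' : a ≠ 0 := PowerSeries.X_ne_zero
  have hxne : x ≠ 0 := by rw [hx]; exact mul_ne_zero (pow_ne_zero 2 ha0') hu0
  have hab : a + b = -x := by rw [hb, hx]; linear_combination -a * hu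
  have hab' : a * b = -x := by rw [hb, hx]; ring
  have hne : a - b ≠ 0 := by
    rw [hb]
    intro h
    have h1 : a * (2 - a) = 0 := by linear_combination (1 - a) * h - a * hu
    rcases mul_eq_zero.1 h1 with h1 | h1
    · exact ha0' h1
    · have := congrArg PowerSeries.constantCoeff h1
      rw [map_sub, ha0, map_ofNat] at this
      simp at this
  obtain ⟨K, hK, hKm⟩ := exists_geometric_catalanMoment (runPoly 2) hx0
  obtain ⟨Ja, hJa, hJam⟩ := exists_geometric_catalanMoment X ha0
  obtain ⟨Jb, hJb, hJbm⟩ := exists_geometric_catalanMoment X hb0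
  obtain ⟨ca, hca, hca'⟩ := catalan_generatingFunction ha0
  obtain ⟨cb, hcb, hcb'⟩ := catalan_generatingFunction hb0
  simp only [catalanFunctional_X_pow] at hJam hJbm
  rw [hca'] at hJam
  rw [hcb'] at hJbm
  rw [← hF] at hKm
  have hsx : PowerSeries.HasSubst x := PowerSeries.HasSubst.of_constantCoeff_zero' hx0
  set T := F.subst x with hT
  have habC := congrArg (PowerSeries.map (C : ℤ →+* ℤ[X])) hab
  have habC' := congrArg (PowerSeries.map (C : ℤ →+* ℤ[X])) hab'
  rw [map_add, map_neg] at habC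
  rw [map_mul, map_neg] at habC'
  -- Partial fractions, with the denominator a - b cleared.
  have hmain : PowerSeries.map C (a - b) * K =
      PowerSeries.map C a * Ja - PowerSeries.map C b * Jb := by
    rw [map_sub]
    rw [runPoly_two, map_mul, map_sub, map_one] at hK
    generalize PowerSeries.map (C : ℤ →+* ℤ[X]) a = a' at *
    generalize PowerSeries.map (C : ℤ →+* ℤ[X]) b = b' at *
    generalize PowerSeries.map (C : ℤ →+* ℤ[X]) x = x' at *
    generalize PowerSeries.C (X : ℤ[X]) = z at *
    have hK' : (1 - z * a') * (1 - z * b') * K = 1 := by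
      linear_combination hK - z * K * habC + z ^ 2 * K * habC'
    have hKJ : K = Ja * Jb := by
      linear_combination (Ja * Jb) * hK' - K * Jb * (1 - z * b') * hJa - K * hJb
    rw [hKJ]
    linear_combination a' * Ja * hJb - b' * Jb * hJa
  have hmom := congrArg catalanMoment hmain
  rw [catalanMoment_map_mul, catalanMoment_sub, catalanMoment_map_mul, catalanMoment_map_mul,
    hKm, hJam, hJbm] at hmom
  obtain ⟨α, hα⟩ : ∃ α, α = a * ca := ⟨_, rfl⟩
  obtain ⟨β, hβ⟩ : ∃ β, β = b * cb := ⟨_, rfl⟩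
  have hα' : a = α - α ^ 2 := by rw [hα]; linear_combination -a * hca
  have hβ' : b = β - β ^ 2 := by rw [hβ]; linear_combination -b * hcb
  rw [← hα, ← hβ] at hmom
  have hαβ : α - β ≠ 0 := by
    intro h
    apply hne
    rw [hα', hβ']
    linear_combination (1 - α - β) * h
  -- Since a - b = (α - β)(1 - α - β), cancelling α - β from `hmom` makes `T` the inverse of 1 - α -
  -- β. The quartic for 1 - α - β, multiplied by T⁴, is then the required equation.
  have hTS : (1 - α - β) * T = 1 := by
    apply mul_left_cancel₀ hαβ
    linear_combination hmom - T * hα' + T * hβ'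
  have hquartic : (1 - α - β) ^ 4 - (2 * x + 1) * (1 - α - β) ^ 2 + x * (x + 4) = 0 := by
    have h1 : α - α ^ 2 + (β - β ^ 2) = -x := by rw [← hα', ← hβ', hab]
    have h2 : (α - α ^ 2) * (β - β ^ 2) = -x := by rw [← hα', ← hβ', hab']
    linear_combination 4 * h2 - (4 * α * β + 2 * (1 - α - β)
      - (α - α ^ 2 + (β - β ^ 2) + x)) * h1
  apply PowerSeries.eq_zero_of_subst_eq_zero hx0 hxne
  rw [← PowerSeries.coe_substAlgHom hsx]
  simp only [map_add, map_sub, map_mul, map_pow, map_one, map_ofNat, PowerSeries.substAlgHom_X, ha]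
  rw [PowerSeries.coe_substAlgHom, ← hT]
  linear_combination T ^ 4 * hquartic + ((2 * x + 1) * T ^ 2 * ((1 - α - β) * T + 1)
    - (((1 - α - β) * T) ^ 3 + ((1 - α - β) * T) ^ 2 + (1 - α - β) * T + 1)) * hTS

end GeneratingFunction

end CatalanMoments

/-! ### The theorem -/

theorem mainTheorem4 (σ : Equiv.Perm (Fin 3)) (hσ : σ = pattern123 ∨ σ = pattern231) :
    -- one occurrence of each letter: the Catalan numbers and their recurrence
    (∀ n : ℕ, wordCount σ 1 n = catalan n) ∧
    (∀ n : ℕ,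
      -2 * ((1 + 2 * (n : ℚ)) * (wordCount σ 1 n : ℚ) / ((n : ℚ) + 2))
        + (wordCount σ 1 (n + 1) : ℚ) = 0) ∧
    -- two occurrences of each letter: the algebraic equation and the recurrence
    (1 - (2 * PowerSeries.X + 1) * wordGF σ 2 ^ 2
        + PowerSeries.X * (PowerSeries.X + 4) * wordGF σ 2 ^ 4 = 0) ∧
    (∀ n : ℕ,
      -3 * ((7 * (n : ℚ) + 12) * (1 + 2 * (n : ℚ)) * (1 + (n : ℚ)) * (wordCount σ 2 n : ℚ)
          / ((2 * (n : ℚ) + 5) * (7 * (n : ℚ) + 5) * ((n : ℚ) + 2)))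
        - (528 + 1426 * (n : ℚ) + 1215 * (n : ℚ) ^ 2 + 329 * (n : ℚ) ^ 3)
            * (wordCount σ 2 (n + 1) : ℚ)
          / (2 * (2 * (n : ℚ) + 5) * (7 * (n : ℚ) + 5) * ((n : ℚ) + 2))
        + (wordCount σ 2 (n + 2) : ℚ) = 0) ∧
    -- three occurrences of each letter: the recurrence
    (∀ n : ℕ,
      -(64 / 3) * ((4 * (n : ℚ) + 1) * (2 * (n : ℚ) + 3) * (4 * (n : ℚ) + 3)
            * (14 * (n : ℚ) + 25) * ((n : ℚ) + 1) * (wordCount σ 3 n : ℚ)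
          / ((3 * (n : ℚ) + 5) * (1 + 2 * (n : ℚ)) * (3 * (n : ℚ) + 7)
            * (14 * (n : ℚ) + 11) * ((n : ℚ) + 2)))
        - (8 / 3) * ((3975 + 20322 * (n : ℚ) + 39676 * (n : ℚ) ^ 2 + 37144 * (n : ℚ) ^ 3
            + 16736 * (n : ℚ) ^ 4 + 2912 * (n : ℚ) ^ 5) * (wordCount σ 3 (n + 1) : ℚ)
          / ((3 * (n : ℚ) + 5) * (1 + 2 * (n : ℚ)) * (3 * (n : ℚ) + 7)
            * (14 * (n : ℚ) + 11) * ((n : ℚ) + 2)))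
        + (wordCount σ 3 (n + 2) : ℚ) = 0) := by
  have hc := wordCount_eq_catalanFunctional hσ
  have h1 : ∀ n : ℕ, wordCount σ 1 n = catalan n := by
    intro n
    have := hc 1 n
    rw [show runPoly 1 = Polynomial.X from rfl, catalanFunctional_X_pow] at this
    exact_mod_cast this
  refine ⟨h1, fun n => ?_, ?_, fun n => ?_, fun n => ?_⟩
  · have h := succ_succ_mul_catalan_succ n
    rw [h1, h1]
    have h' : ((n : ℚ) + 2) * catalan (n + 1) = 2 * (2 * n + 1) * catalan n := by exact_mod_cast h
    field_simp
    linear_combination h'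
  · apply algebraic_equation_of_catalanFunctional
    rw [wordGF]
    simp only [hc]
  · have h := catalanFunctional_runPoly_two_recurrence n
    rw [← hc, ← hc, ← hc] at h
    have h' := congrArg (Int.cast : ℤ → ℚ) h
    push_cast at h'
    field_simp
    linear_combination h'
  · have h := catalanFunctional_runPoly_three_recurrence n
    rw [← hc, ← hc, ← hc] at h
    have h' := congrArg (Int.cast : ℤ → ℚ) h
    push_cast at h'
    field_simp
    linear_combination h'
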